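/- Let $b$ be a prime and let $\mathbb{F}_b$ be the field with $b$ elements. A natural number $n=n_0+n_1b+\cdots+n_ab^a$ in base $b$ is identified with $n(x)=n_0+n_1x+\cdots+n_ax^a\in\mathbb{F}_b[x]$; for $k\in\mathbb{N}_0$ with base-$b$ digits $\kappa_0,\kappa_1,\ldots$ put $\mathrm{tr}_m(k)=\kappa_0+\kappa_1x+\cdots+\kappa_{m-1}x^{m-1}$, applied componentwise to vectors. For a formal Laurent series $\sum_{\ell\ge w}t_\ell x^{-\ell}\in\mathbb{F}_b((x^{-1}))$ put $v_m\big(\sum_{\ell\ge w}t_\ell x^{-\ell}\big)=\sum_{\ell=\max(1,w)}^m t_\ell b^{-\ell}\in[0,1)$. Let $G^*_{b,m}$ be the set of nonzero polynomials over $\mathbb{F}_b$ of degree less than $m$. Let $p\in\mathbb{F}_b[x]$ with $\deg p=m$, let $\boldsymbol\eta=(\eta_{\mathfrak u})_{\mathfrak u\subseteq\{1,\ldots,d\}}$ be positive weights and $\boldsymbol g=(g_1,\ldots,g_d)\in(\mathbb{F}_b[x])^d$. Define $$T_{\boldsymbol\eta}(\boldsymbol g,p)=\sum_{\boldsymbol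 k}\eta_{\operatorname{supp}(\boldsymbol k)}\prod_{j\in\operatorname{supp}(\boldsymbol k)}b^{-\lfloor\log_b k_j\rfloor},$$ where the sum is over all $\boldsymbol 0\ne\boldsymbol k\in\{0,1,\ldots,b^m-1\}^d$ with $\mathrm{tr}_m(\boldsymbol k)\cdot\boldsymbol g\equiv0\pmod p$ and $\operatorname{supp}(\boldsymbol k)=\{j:k_j\neq0\}$. For $p$ irreducible, $1\le s\le d$ and $g_1,\ldots,g_s\in G^*_{b,m}$ let $$K_s(g_1,\ldots,g_s)=\sum_{\emptyset\ne\mathfrak u\subseteq\{1,\ldots,s\}}\eta_{\mathfrak u}\sum_{n=1}^{b^m-1}\prod_{j\in\mathfrak u}\Big((1-b)\Big\lfloor\log_b v_m\Big(\frac{n(x)g_j(x)}{p(x)}\Big)\Big\rfloor-b\Big).$$ We say that $\boldsymbol g$ is constructed by the component-by-component (CBC) algorithm for $p$ and $\boldsymbol\eta$ if $g_1=1$ and, for each $s=2,\ldots,d$, $g_s$ is a minimizer of $g\mapsto K_s(g_1,\ldots,g_{s-1},g)$ over $g\in G^*_{b,m}$. **Theorem.** (i) Let $m\ge4$, $d\ge1$,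 let $p\in\mathbb{F}_b[x]$ be irreducible with $\deg p=m$, let $\boldsymbol\eta=(\eta_{\mathfrak u})_{\mathfrak u\subseteq\{1,\ldots,d\}}$ be positive weights, and let $\boldsymbol g$ be constructed by the CBC algorithm. Then $$T_{\boldsymbol\eta}(\boldsymbol g,p)\le B_{m,d}:=\frac1{b^m}\sum_{\emptyset\ne\mathfrak u\subseteq\{1,\ldots,d\}}\eta_{\mathfrak u}\Big(2((b-1)m)^{|\mathfrak u|}+bm\Big(2(b-1)m+\frac{2b}{b-1}\Big)^{|\mathfrak u|}\Big).$$ (ii) Let $(\eta_{\mathfrak u})$ be a family of positive weights indexed by the finite subsets $\mathfrak u$ of $\{1,2,\ldots\}$ such that $$\sum_{j\ge1}\ \max_{\mathfrak v\subseteq\{1,\ldots,j-1\}}\frac{\eta_{\mathfrak v\cup\{j\}}}{\eta_{\mathfrak v}}<\infty.$$ Then for every $\delta>0$ there is a constant $C>0$, depending only on $b$, $(\eta_{\mathfrak u})$ and $\delta$, such that for all $m\ge4$ and all $d\ge1$, with $N=b^m$, one has $B_{m,d}\le C\,N^{-1+\delta}$; in particular $T_{\boldsymbol\eta}(\boldsymbol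 g,p)\le C\,N^{-1+\delta}$ for every irreducible $p\in\mathbb{F}_b[x]$ of degree $m$ and every $\boldsymbol g\in(G^*_{b,m})^d$ constructed by the CBC algorithm for $p$ and $(\eta_{\mathfrak u})_{\mathfrak u\subseteq\{1,\ldots,d\}}$. -/

import Mathlib

open Polynomial Finset

noncomputable section

namespace PolyLat

/- Coordinates are indexed by `1, …, d`, i.e. by `Finset.Icc 1 d`.  Vectors of polynomials are given
by functions `g : ℕ → (ZMod b)[X]` and weights by functions `η : Finset ℕ → ℝ`; only the values
`g 1, …, g d` and `η u` with `u ⊆ {1, …, d}` enter the `d`-dimensional quantities below. -/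

/-- The polynomial `n(x) = n₀ + n₁ x + ⋯ + n_a x^a` over `𝔽_b` associated with a natural number
`n = n₀ + n₁ b + ⋯ + n_a b^a`. -/
def digitPoly (b n : ℕ) : (ZMod b)[X] :=
  ∑ i ∈ range (Nat.digits b n).length, monomial i (((Nat.digits b n).getD i 0 : ℕ) : ZMod b)

/-- The truncation map `tr_m(k) = κ₀ + κ₁ x + ⋯ + κ_{m-1} x^{m-1}`, where the `κ_i` are the base `b`
digits of `k` (digits beyond the expansion of `k` are zero). -/
def tr (b m k : ℕ) : (ZMod b)[X] :=
  ∑ i ∈ range m, monomial i (((Nat.digits b k).getD i 0 : ℕ) : ZMod b)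

/-- The set `G*_{b,m}` of nonzero polynomials over `𝔽_b` of degree less than `m`. -/
def Gstar (b m : ℕ) : Set (ZMod b)[X] :=
  {g | g ≠ 0 ∧ g.natDegree < m}

/-- The inclusion of `𝔽_b[x]` into the field `𝔽_b((x⁻¹))` of formal Laurent series.  The variable of
`LaurentSeries` plays the role of `x⁻¹`, so that `x` is sent to `single (-1) 1`, and the coefficient
of `x^(-ℓ)` in `L` is `L.coeff ℓ`. -/
def laurentEmb (b : ℕ) : (ZMod b)[X] →+* LaurentSeries (ZMod b) :=
  eval₂RingHom HahnSeries.C (HahnSeries.single (-1 : ℤ) (1 : ZMod b))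

/-- The map `v_m : 𝔽_b((x⁻¹)) → [0,1)`, `v_m (∑ t_ℓ x^(-ℓ)) = ∑_{ℓ=1}^m t_ℓ b^(-ℓ)`. -/
def vm (b m : ℕ) (L : LaurentSeries (ZMod b)) : ℝ :=
  ∑ l ∈ Icc 1 m, ((L.coeff (l : ℤ)).val : ℝ) * ((b : ℝ) ^ l)⁻¹

/-- The coordinate `v_m (n(x) g(x) / p(x))` of the `n`-th point of the polynomial lattice with
modulus `p`, for the component `g` of the generating vector. -/
def coord (b : ℕ) [Fact b.Prime] (m : ℕ) (p g : (ZMod b)[X]) (n : ℕ) : ℝ :=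
  vm b m (laurentEmb b (digitPoly b n * g) / laurentEmb b p)

/-- The function `L_u(x) = ∏_{j ∈ u} ((1 - b) ⌊log_b x_j⌋ - b)`. -/
def Lfun (b : ℕ) (u : Finset ℕ) (x : ℕ → ℝ) : ℝ :=
  ∏ j ∈ u, ((1 - (b : ℝ)) * (⌊Real.logb (b : ℝ) (x j)⌋ : ℝ) - (b : ℝ))

/-- The quality function
`K_{b^m,s,η}(g, p) = ∑_{∅ ≠ u ⊆ {1,…,s}} η_u ∑_{n=1}^{b^m-1} L_u (v_m (n(x) g_u(x) / p(x)))`. -/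
def K (b : ℕ) [Fact b.Prime] (m s : ℕ) (η : Finset ℕ → ℝ) (p : (ZMod b)[X])
    (g : ℕ → (ZMod b)[X]) : ℝ :=
  ∑ u ∈ (Icc 1 s).powerset.erase ∅,
    η u * ∑ n ∈ Ico 1 (b ^ m), Lfun b u (fun j => coord b m p (g j) n)

/-- `g = (g_1, …, g_d)` is an output of the component-by-component construction with modulus `p` and
weights `η`: `g_1 = 1`, and for `s = 2, …, d` the component `g_s` is a minimizer of
`h ↦ K_{b^m,s,η}(g_1, …, g_{s-1}, h)` over `G*_{b,m}` (ties are broken arbitrarily). -/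
def IsCBC (b : ℕ) [Fact b.Prime] (m d : ℕ) (η : Finset ℕ → ℝ) (p : (ZMod b)[X])
    (g : ℕ → (ZMod b)[X]) : Prop :=
  g 1 = 1 ∧ ∀ s ∈ Icc 2 d, g s ∈ Gstar b m ∧
    ∀ h ∈ Gstar b m, K b m s η p g ≤ K b m s η p (Function.update g s h)

/-- `r_{1,η}(k) = η_{supp k}⁻¹ ∏_{j ∈ supp k} b^⌊log_b k_j⌋`. -/
def r1 (b : ℕ) (η : Finset ℕ → ℝ) (k : ℕ →₀ ℕ) : ℝ :=
  (η k.support)⁻¹ * ∏ j ∈ k.support, (b : ℝ) ^ Nat.log b (k j)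

open Classical in
/-- The index set `A_p(g)` of all `k ∈ {0, 1, …, b^m - 1}^d` lying in the dual polynomial lattice,
i.e. with `tr_m(k) · g ≡ 0 (mod p)`.  Vectors `k` are finitely supported functions that vanish
outside of `{1, …, d}`. -/
def A (b m d : ℕ) (p : (ZMod b)[X]) (g : ℕ → (ZMod b)[X]) : Finset (ℕ →₀ ℕ) :=
  ((Icc 1 d).finsupp fun _ => range (b ^ m)).filter
    fun k => p ∣ ∑ j ∈ Icc 1 d, tr b m (k j) * g j

/-- The quality measure `T_η(g, p) = ∑_{0 ≠ k ∈ A_p(g)} r_{1,η}(k)⁻¹`. -/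
def T (b m d : ℕ) (η : Finset ℕ → ℝ) (p : (ZMod b)[X]) (g : ℕ → (ZMod b)[X]) : ℝ :=
  ∑ k ∈ (A b m d p g).erase 0, (r1 b η k)⁻¹

/-- The right-hand side of the estimate:
`b^(-m) ∑_{∅ ≠ u ⊆ {1,…,d}} η_u (2 ((b-1)m)^|u| + b m (2(b-1)m + 2b/(b-1))^|u|)`. -/
def bound (b m d : ℕ) (η : Finset ℕ → ℝ) : ℝ :=
  1 / (b : ℝ) ^ m * ∑ u ∈ (Icc 1 d).powerset.erase ∅,
    η u * (2 * (((b : ℝ) - 1) * m) ^ u.card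
      + b * m * (2 * ((b : ℝ) - 1) * m + 2 * b / ((b : ℝ) - 1)) ^ u.card)

/-- `max_{v ⊆ {1,…,j-1}} η_{v ∪ {j}} / η_v`. -/
def maxRatio (η : Finset ℕ → ℝ) (j : ℕ) : ℝ :=
  (Ico 1 j).powerset.sup' ⟨∅, empty_mem_powerset _⟩ fun v => η (insert j v) / η v

end PolyLat

end

/-!
Write `N = b ^ m`, `M = (b - 1) m`, and let `χ` be the standard character of `𝔽_b`.

*Duality.* The character `y ↦ χ(t₁)`, with `t₁` the coefficient of `x⁻¹` in the Laurent expansion of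
`y / p` (`PolyLat.resChar`), turns Walsh functions at the points of the polynomial lattice into
characters of `𝔽_b[x]`. Blockwise summation of Dirichlet kernels shows that
`∑_{1 ≤ k < N} b^(-⌊log_b k⌋) wal_k` takes the value `(1 - b) ⌊log_b t⌋ - b` at the nonzero points
`t` (`walshKernel_of_not_dvd`) and the value `M` at `0` (`walshKernel_of_dvd`). Multiplying over
`j ∈ u` and summing over the points, orthogonality leaves exactly the vectors `k` of the dual lattice
with support `u` (`sum_prod_walshKernel`). With `S_u ≥ 0` the corresponding part of `T`
(`dualSum`), the sum of `L_u` over the nonzero points is `N S_u - M^|u|` (`sum_prod_logFactor`), and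
hence `N T = ∑_u η_u M^|u| + K_d`.

*Averaging.* Since `p` is irreducible, for a nonzero point the average over all candidates for the
new component of its factor is `-M / (N - 1)`, and the remaining factors sum to at least `-M^|v|`.
The minimizer is no worse than the average, so `(N - 1) K_d ≤ ∑_u η_u M^|u|` (`K_le_of_isCBC`), and
`T ≤ (2 / N) ∑_u η_u M^|u|` (`T_le_of_isCBC`). This is already less than the asserted bound.

*Dimension-free bound.* The bound is at most `(X / N) ∑_u η_u X^|u|` with `X = 2 b m` (`bound_le`),
and the sum is at most `η_∅ ∏_j (1 + X c_j)` with `c_j` the maximal ratio of weights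
(`sum_weights_le_prod`). As `∑ c_j` converges, the product grows more slowly than `exp (ε X)` for
every `ε > 0`, uniformly in the dimension (`exists_mul_prod_le_exp`); a suitable `ε` turns this into
`N ^ δ`.
-/

namespace PolyLat

/-! ### Base `b` digits and polynomials of small degree -/

section Digits

variable {b : ℕ}

lemma coeff_tr (m k i : ℕ) :
    (tr b m k).coeff i = if i < m then (((Nat.digits b k).getD i 0 : ℕ) : ZMod b) else 0 := by
  simp [tr, coeff_monomial]

lemma coeff_digitPoly (n i : ℕ) :
    (digitPoly b n).coeff i = (((Nat.digits b n).getD i 0 : ℕ) : ZMod b) := by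
  rw [digitPoly, finsetSum_coeff]
  simp only [coeff_monomial, sum_ite_eq', mem_range]
  split_ifs with h
  · rfl
  · rw [List.getD_eq_default _ _ (not_lt.mp h), Nat.cast_zero]

lemma getD_digits_eq_zero (hb : 1 < b) {n m i : ℕ} (hn : n < b ^ m) (hi : m ≤ i) :
    (Nat.digits b n).getD i 0 = 0 :=
  List.getD_eq_default _ _ (((Nat.digits_length_le_iff hb n).mpr hn).trans hi)

lemma digitPoly_eq_tr (hb : 1 < b) {n m : ℕ} (hn : n < b ^ m) : digitPoly b n = tr b m n := by
  ext i
  rw [coeff_digitPoly, coeff_tr]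
  split_ifs with h
  · rfl
  · rw [getD_digits_eq_zero hb hn (not_lt.mp h), Nat.cast_zero]

lemma tr_mem_degreeLT (hb : 1 < b) {m r k : ℕ} (hk : k < b ^ r) :
    tr b m k ∈ degreeLT (ZMod b) r := by
  rw [mem_degreeLT, degree_lt_iff_coeff_zero]
  intro i hi
  rw [coeff_tr]
  split_ifs
  · rw [getD_digits_eq_zero hb hk (by exact_mod_cast hi), Nat.cast_zero]
  · rfl

lemma tr_injOn (hb : 1 < b) (m : ℕ) : Set.InjOn (tr b m) (range (b ^ m)) := by
  intro k hk k' hk' h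
  rw [coe_range, Set.mem_Iio] at hk hk'
  have key : finFunctionFinEquiv.symm (⟨k, hk⟩ : Fin (b ^ m))
      = finFunctionFinEquiv.symm (⟨k', hk'⟩ : Fin (b ^ m)) := by
    funext i
    apply Fin.ext
    have hi := congrArg (fun q => coeff q (i : ℕ)) h
    simp only [coeff_tr, i.isLt, if_true, Nat.getD_digits _ _ hb] at hi
    simpa [ZMod.natCast_eq_natCast_iff'] using hi
  simpa using finFunctionFinEquiv.symm.injective key

lemma card_degreeLT [Fact b.Prime] (r : ℕ) [Fintype (degreeLT (ZMod b) r)] :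
    Fintype.card (degreeLT (ZMod b) r) = b ^ r := by
  rw [Fintype.card_congr (degreeLTEquiv (ZMod b) r).toEquiv, Fintype.card_fun, Fintype.card_fin,
    ZMod.card]

/-- The numbers below `b ^ r` enumerate the polynomials of degree less than `r`. -/
lemma sum_tr_eq_sum_degreeLT [Fact b.Prime] {m r : ℕ} (hr : r ≤ m)
    [Fintype (degreeLT (ZMod b) r)] (F : (ZMod b)[X] → ℂ) :
    ∑ k ∈ range (b ^ r), F (tr b m k) = ∑ f : degreeLT (ZMod b) r, F f := by
  have hb : 1 < b := (Fact.out : b.Prime).one_lt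
  have hmem : ∀ k (_ : k ∈ range (b ^ r)), tr b m k ∈ degreeLT (ZMod b) r := fun k hk =>
    tr_mem_degreeLT hb (mem_range.mp hk)
  have hinj : ∀ k k' (_ : k ∈ range (b ^ r)) (_ : k' ∈ range (b ^ r)),
      tr b m k = tr b m k' → k = k' := fun k k' hk hk' h =>
    tr_injOn hb m (range_mono (Nat.pow_le_pow_right hb.le hr) hk)
      (range_mono (Nat.pow_le_pow_right hb.le hr) hk') h
  refine sum_bij (fun k hk => (⟨tr b m k, hmem k hk⟩ : degreeLT (ZMod b) r))
    (fun _ _ => mem_univ _) (fun k hk k' hk' h => hinj k k' hk hk' (congrArg Subtype.val h))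
    (fun f _ => ?_) (fun _ _ => rfl)
  obtain ⟨k, hk, h⟩ := surj_on_of_inj_on_of_card_le (s := range (b ^ r)) (t := univ)
    (fun k hk => (⟨tr b m k, hmem k hk⟩ : degreeLT (ZMod b) r)) (fun _ _ => mem_univ _)
    (fun k k' hk hk' h => hinj k k' hk hk' (congrArg Subtype.val h))
    (by rw [card_univ, card_degreeLT, card_range]) f (mem_univ _)
  exact ⟨k, hk, h.symm⟩

end Digits

/-! ### Laurent expansions of rational functions -/

section Laurent

variable {b : ℕ}

lemma laurentEmb_monomial (n : ℕ) (a : ZMod b) :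
    laurentEmb b (monomial n a) = HahnSeries.single (-(n : ℤ)) a := by
  rw [laurentEmb, coe_eval₂RingHom, eval₂_monomial, HahnSeries.single_pow]
  simp [HahnSeries.C_apply, HahnSeries.single_mul_single]

lemma coeff_laurentEmb_neg (q : (ZMod b)[X]) (i : ℕ) :
    (laurentEmb b q).coeff (-(i : ℤ)) = q.coeff i := by
  induction q using Polynomial.induction_on' with
  | add p q hp hq => rw [map_add, HahnSeries.coeff_add, hp, hq, coeff_add]
  | monomial n a =>
    rw [laurentEmb_monomial, HahnSeries.coeff_single, coeff_monomial]
    simp [eq_comm]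

lemma coeff_laurentEmb_pos (q : (ZMod b)[X]) {l : ℤ} (hl : 0 < l) :
    (laurentEmb b q).coeff l = 0 := by
  induction q using Polynomial.induction_on' with
  | add p q hp hq => rw [map_add, HahnSeries.coeff_add, hp, hq, add_zero]
  | monomial n a =>
    rw [laurentEmb_monomial, HahnSeries.coeff_single, if_neg (by omega)]

lemma laurentEmb_injective : Function.Injective (laurentEmb b) := fun p q h => by
  ext i
  rw [← coeff_laurentEmb_neg, h, coeff_laurentEmb_neg]

lemma laurentEmb_ne_zero {q : (ZMod b)[X]} (hq : q ≠ 0) : laurentEmb b q ≠ 0 :=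
  (map_ne_zero_iff _ laurentEmb_injective).mpr hq

lemma order_laurentEmb {q : (ZMod b)[X]} (hq : q ≠ 0) :
    (laurentEmb b q).order = -(q.natDegree : ℤ) := by
  have h0 := laurentEmb_ne_zero hq
  apply le_antisymm
  · apply HahnSeries.order_le_of_coeff_ne_zero
    rw [coeff_laurentEmb_neg]
    exact leadingCoeff_ne_zero.mpr hq
  · by_contra! hlt
    obtain ⟨i, hi⟩ := Int.eq_ofNat_of_zero_le (a := -(laurentEmb b q).order) (by omega)
    apply mt HahnSeries.coeff_order_eq_zero.mp h0
    rw [show (laurentEmb b q).order = -(i : ℤ) by omega, coeff_laurentEmb_neg]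
    exact coeff_eq_zero_of_natDegree_lt (by omega)

lemma coeff_one_laurentEmb_mul {f : (ZMod b)[X]} {r : ℕ} (hf : f ∈ degreeLT (ZMod b) r)
    (L : LaurentSeries (ZMod b)) :
    (laurentEmb b f * L).coeff 1 = ∑ i ∈ range r, f.coeff i * L.coeff ((i : ℤ) + 1) := by
  have hsum : f = ∑ i ∈ range r, monomial i (f.coeff i) := by
    ext j
    simp only [finsetSum_coeff, coeff_monomial, sum_ite_eq', mem_range]
    split_ifs with h
    · rfl
    · rw [mem_degreeLT, degree_lt_iff_coeff_zero] at hf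
      exact hf j (by exact_mod_cast not_lt.mp h)
  conv_lhs => rw [hsum]
  rw [map_sum, sum_mul, HahnSeries.coeff_sum]
  refine sum_congr rfl fun i _ => ?_
  rw [laurentEmb_monomial, HahnSeries.coeff_single_mul]
  congr 2
  omega

variable [Fact b.Prime]

/-- The Laurent expansion of the rational function `y / p`. -/
noncomputable def expansion (p y : (ZMod b)[X]) : LaurentSeries (ZMod b) := laurentEmb b y / laurentEmb b p

lemma expansion_mul_left (p f y : (ZMod b)[X]) :
    expansion p (f * y) = laurentEmb b f * expansion p y := by
  rw [expansion, expansion, map_mul, mul_div_assoc]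

lemma coeff_expansion_of_dvd {p y : (ZMod b)[X]} (hp : p ≠ 0) (h : p ∣ y) {l : ℤ} (hl : 0 < l) :
    (expansion p y).coeff l = 0 := by
  obtain ⟨q, rfl⟩ := h
  rw [expansion, map_mul, mul_div_cancel_left₀ _ (laurentEmb_ne_zero hp)]
  exact coeff_laurentEmb_pos q hl

/-- A rational function `y / p` that is not a polynomial has a nonzero coefficient among those of
`x⁻¹, …, x⁻ᵐ`, where `m = deg p`: its fractional part `r / p` has order `m - deg r`. -/
lemma exists_coeff_expansion_ne_zero {p y : (ZMod b)[X]} (hp : p ≠ 0) (h : ¬ p ∣ y) :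
    ∃ l : ℕ, 1 ≤ l ∧ l ≤ p.natDegree ∧ (expansion p y).coeff l ≠ 0 := by
  set r := y % p with hr
  have hr0 : r ≠ 0 := fun h0 => h (EuclideanDomain.mod_eq_zero.mp h0)
  have hdeg : r.natDegree < p.natDegree :=
    natDegree_lt_natDegree hr0 (EuclideanDomain.mod_lt y hp)
  have hp' := laurentEmb_ne_zero hp
  have hsplit : expansion p y = laurentEmb b (y / p) + expansion p r := by
    rw [expansion, expansion, div_eq_iff hp', add_mul, div_mul_cancel₀ _ hp', ← map_mul, ← map_add,
      mul_comm, hr, EuclideanDomain.div_add_mod]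
  have hmul : expansion p r * laurentEmb b p = laurentEmb b r := div_mul_cancel₀ _ hp'
  have hne : expansion p r ≠ 0 := div_ne_zero (laurentEmb_ne_zero hr0) hp'
  have hord := congrArg HahnSeries.order hmul
  rw [HahnSeries.order_mul hne hp', order_laurentEmb hp, order_laurentEmb hr0] at hord
  refine ⟨p.natDegree - r.natDegree, by omega, by omega, ?_⟩
  rw [hsplit, HahnSeries.coeff_add, coeff_laurentEmb_pos _ (by omega), zero_add,
    show ((p.natDegree - r.natDegree : ℕ) : ℤ) = (expansion p r).order by omega]
  exact mt HahnSeries.coeff_order_eq_zero.mp hne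

end Laurent

/-! ### Walsh functions and orthogonality -/

section Walsh

variable {b : ℕ} [Fact b.Prime]

/-- The additive character `y ↦ χ(t₁)` of `𝔽_b[x]`, where `t₁` is the coefficient of `x⁻¹` in the
Laurent expansion of `y / p` and `χ` is the standard character of `𝔽_b`. The Walsh function `wal_k`
with `k < b ^ m` takes the value `resChar p (tr b m k * y)` at the point `v_m (y / p)`. -/
noncomputable def resChar (p : (ZMod b)[X]) : AddChar (ZMod b)[X] ℂ :=
  ZMod.stdAddChar.compAddMonoidHom
    { toFun := fun y => (expansion p y).coeff 1
      map_zero' := by simp [expansion]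
      map_add' := fun y z => by simp [expansion, add_div] }

lemma resChar_apply (p y : (ZMod b)[X]) :
    resChar p y = ZMod.stdAddChar ((expansion p y).coeff 1) := rfl

lemma resChar_eq_one_iff (p y : (ZMod b)[X]) :
    resChar p y = 1 ↔ (expansion p y).coeff 1 = 0 := by
  rw [resChar_apply, ← AddChar.map_zero_eq_one (ZMod.stdAddChar (N := b)), ZMod.injective_stdAddChar.eq_iff]

open Classical in
lemma sum_resChar_tr_mul {m r : ℕ} (hr : r ≤ m) (p y : (ZMod b)[X]) :
    ∑ k ∈ range (b ^ r), resChar p (tr b m k * y)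
      = if ∀ l : ℕ, 1 ≤ l → l ≤ r → (expansion p y).coeff l = 0 then (b : ℂ) ^ r else 0 := by
  have : Fintype (degreeLT (ZMod b) r) :=
    Fintype.ofEquiv _ (degreeLTEquiv (ZMod b) r).toEquiv.symm
  rw [sum_tr_eq_sum_degreeLT hr fun f => resChar p (f * y)]
  set ψ : AddChar (degreeLT (ZMod b) r) ℂ := (resChar p).compAddMonoidHom
    ((AddMonoidHom.mulRight y).comp (degreeLT (ZMod b) r).subtype.toAddMonoidHom) with hψ
  have happ : ∀ f, ψ f = resChar p (f * y) := fun f => rfl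
  simp_rw [← happ]
  rw [AddChar.sum_eq_ite, card_degreeLT, Nat.cast_pow]
  refine if_congr ?_ rfl rfl
  rw [AddChar.eq_zero_iff]
  simp_rw [happ, resChar_eq_one_iff, expansion_mul_left]
  constructor
  · intro h l hl hlr
    have hmem : monomial (l - 1) (1 : ZMod b) ∈ degreeLT (ZMod b) r := by
      rw [mem_degreeLT]
      exact (degree_monomial_le _ _).trans_lt (by exact_mod_cast (by omega : l - 1 < r))
    have := h ⟨_, hmem⟩
    rw [laurentEmb_monomial, HahnSeries.coeff_single_mul, one_mul] at this
    rwa [show (l : ℤ) = 1 - -((l - 1 : ℕ) : ℤ) by omega]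
  · intro h f
    rw [coeff_one_laurentEmb_mul f.2]
    refine sum_eq_zero fun i hi => ?_
    rw [mem_range] at hi
    have := h (i + 1) (by omega) (by omega)
    rw [Nat.cast_add, Nat.cast_one] at this
    rw [this, mul_zero]

end Walsh

/-! ### The weighted Walsh kernel in closed form -/

section Kernel

variable {b : ℕ} [Fact b.Prime]

/-- The one-dimensional kernel `∑_{1 ≤ k < b^m} b^(-⌊log_b k⌋) wal_k(v_m (y / p))`. -/
noncomputable def walshKernel (m : ℕ) (p y : (ZMod b)[X]) : ℂ :=
  ∑ k ∈ Ico 1 (b ^ m), ((b : ℂ) ^ Nat.log b k)⁻¹ * resChar p (tr b m k * y)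

/-- The factor `(1 - b) ⌊log_b v_m (y / p)⌋ - b` of the figure of merit. It is
used only for `p ∤ y`, where `v_m (y / p) > 0` and the logarithm is not a junk value. -/
noncomputable def logFactor (m : ℕ) (p y : (ZMod b)[X]) : ℝ :=
  (1 - (b : ℝ)) * (⌊Real.logb (b : ℝ) (vm b m (expansion p y))⌋ : ℝ) - (b : ℝ)

/-- On the block `b ^ r ≤ k < b ^ (r + 1)` the weight is constant, and the Walsh functions sum to
the difference of two Dirichlet kernels. Here `ℓ` is the position of the first nonzero coefficient
of `y / p` after the radix point, with `ℓ > m` allowed when there is none up to `m`. -/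
lemma sum_Ico_weighted_resChar {m ℓ : ℕ} (hℓ : 1 ≤ ℓ) (p y : (ZMod b)[X])
    (h0 : ∀ l : ℕ, 1 ≤ l → l < ℓ → (expansion p y).coeff l = 0)
    (h1 : ℓ ≤ m → (expansion p y).coeff ℓ ≠ 0) {r : ℕ} (hr : r ≤ m) :
    ∑ k ∈ Ico 1 (b ^ r), ((b : ℂ) ^ Nat.log b k)⁻¹ * resChar p (tr b m k * y)
      = if r < ℓ then ((b : ℂ) - 1) * r else ((b : ℂ) - 1) * ℓ - b := by
  have hb : 1 < b := (Fact.out : b.Prime).one_lt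
  have hb0 : (b : ℂ) ≠ 0 := by exact_mod_cast (by omega : b ≠ 0)
  have hE : ∀ s, s ≤ m → ∑ k ∈ range (b ^ s), resChar p (tr b m k * y)
      = if s < ℓ then (b : ℂ) ^ s else 0 := by
    intro s hs
    rw [sum_resChar_tr_mul hs]
    refine if_congr ⟨fun h => ?_, fun h l hl hls => h0 l hl (by omega)⟩ rfl rfl
    by_contra! hle
    exact h1 (by omega) (h ℓ hℓ hle)
  induction r with
  | zero => simp [show 0 < ℓ by omega]
  | succ r ih =>
    have hpow : b ^ r ≤ b ^ (r + 1) := Nat.pow_le_pow_right hb.le (Nat.le_succ r)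
    rw [← sum_Ico_consecutive _ (Nat.one_le_pow _ _ (by omega)) hpow, ih (by omega)]
    have hblock : ∑ k ∈ Ico (b ^ r) (b ^ (r + 1)),
        ((b : ℂ) ^ Nat.log b k)⁻¹ * resChar p (tr b m k * y)
        = ((b : ℂ) ^ r)⁻¹ * ((if r + 1 < ℓ then (b : ℂ) ^ (r + 1) else 0)
          - if r < ℓ then (b : ℂ) ^ r else 0) := by
      rw [← hE _ hr, ← hE r (by omega), ← sum_Ico_eq_sub _ hpow, mul_sum]
      refine sum_congr rfl fun k hk => ?_
      rw [mem_Ico] at hk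
      rw [Nat.log_eq_of_pow_le_of_lt_pow hk.1 hk.2]
    rw [hblock]
    have hbr : (b : ℂ) ^ r ≠ 0 := pow_ne_zero _ hb0
    rcases lt_trichotomy (r + 1) ℓ with h | h | h
    · rw [if_pos (by omega), if_pos h, if_pos h, if_pos (by omega)]
      field_simp
      push_cast
      ring
    · rw [if_pos (by omega), if_neg (by omega), if_pos (by omega), if_neg (by omega), ← h]
      field_simp
      push_cast
      ring
    · rw [if_neg (by omega), if_neg (by omega), if_neg (by omega), if_neg (by omega)]
      simp

lemma walshKernel_of_dvd (m : ℕ) {p y : (ZMod b)[X]} (hp : p ≠ 0) (h : p ∣ y) :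
    walshKernel m p y = (((b : ℝ) - 1) * m : ℝ) := by
  rw [walshKernel, sum_Ico_weighted_resChar (ℓ := m + 1) (by omega) p y
    (fun l hl _ => coeff_expansion_of_dvd hp h (by exact_mod_cast hl)) (fun h => by omega) le_rfl,
    if_pos (by omega)]
  push_cast
  rfl

lemma sum_digits_le {t : ℕ → ℝ} (ht : ∀ l, t l ≤ (b : ℝ) - 1) {j m : ℕ} (hjm : j ≤ m)
    (h0 : ∀ l, 1 ≤ l → l ≤ j → t l = 0) :
    ∑ l ∈ Icc 1 m, t l * ((b : ℝ) ^ l)⁻¹ ≤ ((b : ℝ) ^ j)⁻¹ - ((b : ℝ) ^ m)⁻¹ := by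
  have hb : (0 : ℝ) < b := by exact_mod_cast (Fact.out : b.Prime).pos
  induction m, hjm using Nat.le_induction with
  | base =>
    rw [sub_self, sum_eq_zero]
    intro l hl
    rw [mem_Icc] at hl
    rw [h0 l hl.1 hl.2, zero_mul]
  | succ m _ ih =>
    rw [sum_Icc_succ_top (by omega)]
    have hstep : t (m + 1) * ((b : ℝ) ^ (m + 1))⁻¹ ≤ ((b : ℝ) - 1) * ((b : ℝ) ^ (m + 1))⁻¹ :=
      mul_le_mul_of_nonneg_right (ht _) (by positivity)
    have hid : ((b : ℝ) - 1) * ((b : ℝ) ^ (m + 1))⁻¹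
        = ((b : ℝ) ^ m)⁻¹ - ((b : ℝ) ^ (m + 1))⁻¹ := by
      field_simp
      ring
    linarith

/-- If the first nonzero digit of a point of `[0, 1)` is the `ℓ`-th, the point lies in
`[b ^ (-ℓ), b ^ (1 - ℓ))`. -/
lemma floor_logb_vm {m ℓ : ℕ} (hℓ : 1 ≤ ℓ) (hℓm : ℓ ≤ m) (L : LaurentSeries (ZMod b))
    (h0 : ∀ l : ℕ, 1 ≤ l → l < ℓ → L.coeff l = 0) (h1 : L.coeff ℓ ≠ 0) :
    ⌊Real.logb (b : ℝ) (vm b m L)⌋ = -(ℓ : ℤ) := by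
  have hb : (1 : ℝ) < b := by exact_mod_cast (Fact.out : b.Prime).one_lt
  have hb0 : (0 : ℝ) < b := by linarith
  have hlow : ((b : ℝ) ^ ℓ)⁻¹ ≤ vm b m L := by
    have hone : (1 : ℝ) ≤ ((L.coeff (ℓ : ℤ)).val : ℝ) := by
      exact_mod_cast Nat.one_le_iff_ne_zero.mpr ((ZMod.val_ne_zero _).mpr h1)
    calc ((b : ℝ) ^ ℓ)⁻¹ ≤ ((L.coeff (ℓ : ℤ)).val : ℝ) * ((b : ℝ) ^ ℓ)⁻¹ :=
          le_mul_of_one_le_left (by positivity) hone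
      _ ≤ vm b m L := single_le_sum
          (f := fun l : ℕ => ((L.coeff (l : ℤ)).val : ℝ) * ((b : ℝ) ^ l)⁻¹)
          (fun l _ => by positivity) (mem_Icc.mpr ⟨hℓ, hℓm⟩)
  have hupp : vm b m L < ((b : ℝ) ^ (ℓ - 1))⁻¹ := by
    have := sum_digits_le (b := b) (t := fun l : ℕ => ((L.coeff (l : ℤ)).val : ℝ)) (j := ℓ - 1)
      (m := m) (fun l => ?_) (by omega) (fun l hl hl' => ?_)
    · have hpos : (0 : ℝ) < ((b : ℝ) ^ m)⁻¹ := by positivity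
      rw [vm]
      linarith
    · have hlt : (L.coeff (l : ℤ)).val + 1 ≤ b := ZMod.val_lt _
      have : ((L.coeff (l : ℤ)).val : ℝ) + 1 ≤ b := by exact_mod_cast hlt
      linarith
    · rw [h0 l hl (by omega), ZMod.val_zero, Nat.cast_zero]
  have hpos : 0 < vm b m L := lt_of_lt_of_le (by positivity) hlow
  rw [Int.floor_eq_iff, Real.le_logb_iff_rpow_le hb hpos, Real.logb_lt_iff_lt_rpow hb hpos]
  constructor
  · rw [Int.cast_neg, Int.cast_natCast, Real.rpow_neg hb0.le, Real.rpow_natCast]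
    exact hlow
  · rw [show (((-(ℓ : ℤ) : ℤ) : ℝ) + 1) = -((ℓ - 1 : ℕ) : ℝ) by
      rw [Nat.cast_sub hℓ]; push_cast; ring, Real.rpow_neg hb0.le, Real.rpow_natCast]
    exact hupp

lemma walshKernel_of_not_dvd {m : ℕ} {p y : (ZMod b)[X]} (hp : p ≠ 0) (hpm : p.natDegree = m)
    (h : ¬ p ∣ y) : walshKernel m p y = (logFactor m p y : ℝ) := by
  have hex := exists_coeff_expansion_ne_zero hp h
  rw [hpm] at hex
  classical
  obtain ⟨hℓ, hℓm, h1⟩ := Nat.find_spec hex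
  set ℓ := Nat.find hex
  have h0 : ∀ l : ℕ, 1 ≤ l → l < ℓ → (expansion p y).coeff l = 0 := fun l hl hlt => by
    by_contra hne
    exact Nat.find_min hex hlt ⟨hl, by omega, hne⟩
  rw [walshKernel, sum_Ico_weighted_resChar hℓ p y h0 (fun _ => h1) le_rfl, if_neg (by omega),
    logFactor, floor_logb_vm hℓ hℓm _ h0 h1]
  push_cast
  ring

end Kernel

/-! ### Duality between a polynomial lattice and its dual -/

section Duality

variable {b : ℕ} [Fact b.Prime]

open Classical in
/-- The contribution of the vectors `k` with support exactly `u` to the quality measure `T`, without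
the weight `η u`. -/
noncomputable def dualSum (m : ℕ) (p : (ZMod b)[X]) (g : ℕ → (ZMod b)[X]) (u : Finset ℕ) : ℝ :=
  ∑ k ∈ (u.finsupp fun _ => Ico 1 (b ^ m)).filter fun k => p ∣ ∑ j ∈ u, tr b m (k j) * g j,
    ∏ j ∈ u, ((b : ℝ) ^ Nat.log b (k j))⁻¹

lemma dualSum_nonneg (m : ℕ) (p : (ZMod b)[X]) (g : ℕ → (ZMod b)[X]) (u : Finset ℕ) :
    0 ≤ dualSum m p g u :=
  sum_nonneg fun _ _ => prod_nonneg fun _ _ => by positivity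

open Classical in
lemma sum_resChar_digitPoly_mul {m : ℕ} {p : (ZMod b)[X]} (hp : p ≠ 0) (hpm : p.natDegree = m)
    (f : (ZMod b)[X]) :
    ∑ n ∈ range (b ^ m), resChar p (digitPoly b n * f) = if p ∣ f then (b : ℂ) ^ m else 0 := by
  have hb : 1 < b := (Fact.out : b.Prime).one_lt
  rw [← show _ = ∑ n ∈ range (b ^ m), resChar p (digitPoly b n * f) from
    sum_congr rfl fun n hn => by rw [digitPoly_eq_tr hb (mem_range.mp hn)],
    sum_resChar_tr_mul le_rfl]
  refine if_congr ⟨fun h => ?_, fun h l hl _ =>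
    coeff_expansion_of_dvd hp h (by exact_mod_cast hl)⟩ rfl rfl
  by_contra hnd
  obtain ⟨l, hl, hlm, hne⟩ := exists_coeff_expansion_ne_zero hp hnd
  exact hne (h l hl (hpm ▸ hlm))

lemma resChar_sum {ι : Type*} (p : (ZMod b)[X]) (s : Finset ι) (f : ι → (ZMod b)[X]) :
    resChar p (∑ i ∈ s, f i) = ∏ i ∈ s, resChar p (f i) := by
  classical
  induction s using Finset.induction_on with
  | empty => simp
  | insert a s ha ih => rw [sum_insert ha, prod_insert ha, AddChar.map_add_eq_mul, ih]

/-- Expanding the product of kernels over `k`, the sum over all points of the lattice keeps exactly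
the `k` in the dual lattice. -/
lemma sum_prod_walshKernel {m : ℕ} {p : (ZMod b)[X]} (hp : p ≠ 0) (hpm : p.natDegree = m)
    (g : ℕ → (ZMod b)[X]) (u : Finset ℕ) :
    ∑ n ∈ range (b ^ m), ∏ j ∈ u, walshKernel m p (digitPoly b n * g j)
      = (b : ℂ) ^ m * (dualSum m p g u : ℝ) := by
  classical
  have hexp : ∀ n, ∏ j ∈ u, walshKernel m p (digitPoly b n * g j)
      = ∑ k ∈ u.finsupp fun _ => Ico 1 (b ^ m), (∏ j ∈ u, ((b : ℂ) ^ Nat.log b (k j))⁻¹)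
        * resChar p (digitPoly b n * ∑ j ∈ u, tr b m (k j) * g j) := by
    intro n
    simp only [walshKernel]
    rw [prod_sum, Finset.finsupp, sum_map]
    refine sum_congr (by congr!) fun q _ => ?_
    rw [mul_sum, resChar_sum, ← prod_mul_distrib, ← prod_attach u]
    refine prod_congr rfl fun x _ => ?_
    simp only [Function.Embedding.coeFn_mk, Finsupp.indicator_of_mem x.2]
    rw [mul_left_comm]
  simp_rw [hexp]
  rw [sum_comm]
  simp_rw [← mul_sum, sum_resChar_digitPoly_mul hp hpm]
  rw [dualSum, sum_filter]
  push_cast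
  rw [mul_sum]
  refine sum_congr rfl fun k _ => ?_
  split_ifs
  · push_cast
    rw [mul_comm]
  · simp

lemma digitPoly_ne_zero {m n : ℕ} (hn : n ∈ Ico 1 (b ^ m)) : digitPoly b n ≠ 0 := by
  have hb : 1 < b := (Fact.out : b.Prime).one_lt
  rw [mem_Ico] at hn
  rw [digitPoly_eq_tr hb hn.2]
  intro h
  have h0 : tr b m 0 = 0 := by simp [tr]
  have := tr_injOn hb m (mem_coe.mpr (mem_range.mpr hn.2))
    (mem_coe.mpr (mem_range.mpr (by omega))) (h.trans h0.symm)
  omega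

lemma natDegree_digitPoly_lt {m n : ℕ} (hn : n ∈ Ico 1 (b ^ m)) :
    (digitPoly b n).natDegree < m := by
  have hb : 1 < b := (Fact.out : b.Prime).one_lt
  have h0 := digitPoly_ne_zero hn
  rw [mem_Ico] at hn
  rw [natDegree_lt_iff_degree_lt h0, ← mem_degreeLT, digitPoly_eq_tr hb hn.2]
  exact tr_mem_degreeLT hb hn.2

lemma digitPoly_mem_Gstar {m n : ℕ} (hn : n ∈ Ico 1 (b ^ m)) : digitPoly b n ∈ Gstar b m :=
  ⟨digitPoly_ne_zero hn, natDegree_digitPoly_lt hn⟩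

lemma not_dvd_of_mem_Gstar {m : ℕ} {p g : (ZMod b)[X]} (hpm : p.natDegree = m)
    (hg : g ∈ Gstar b m) : ¬ p ∣ g := fun h => by
  have := natDegree_le_of_dvd h hg.1
  have := hg.2
  omega

lemma sum_prod_logFactor {m : ℕ} {p : (ZMod b)[X]} (hp : Irreducible p) (hpm : p.natDegree = m)
    {g : ℕ → (ZMod b)[X]} {u : Finset ℕ} (hg : ∀ j ∈ u, ¬ p ∣ g j) :
    ∑ n ∈ Ico 1 (b ^ m), ∏ j ∈ u, logFactor m p (digitPoly b n * g j)
      = (b : ℝ) ^ m * dualSum m p g u - (((b : ℝ) - 1) * m) ^ u.card := by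
  have hb : 1 < b := (Fact.out : b.Prime).one_lt
  have h := sum_prod_walshKernel hp.ne_zero hpm g u
  have h0 : digitPoly b 0 = 0 := by simp [digitPoly]
  rw [range_eq_Ico, sum_eq_sum_Ico_succ_bot (Nat.pow_pos (by omega))] at h
  simp only [h0, zero_mul, walshKernel_of_dvd m hp.ne_zero (dvd_zero p), prod_const, zero_add] at h
  have hcongr : ∑ n ∈ Ico 1 (b ^ m), ∏ j ∈ u, walshKernel m p (digitPoly b n * g j)
      = ∑ n ∈ Ico 1 (b ^ m), ∏ j ∈ u, ((logFactor m p (digitPoly b n * g j) : ℝ) : ℂ) :=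
    sum_congr rfl fun n hn => prod_congr rfl fun j hj => by
      refine walshKernel_of_not_dvd hp.ne_zero hpm fun hd => ?_
      rcases hp.prime.dvd_or_dvd hd with hd | hd
      · exact not_dvd_of_mem_Gstar hpm (digitPoly_mem_Gstar hn) hd
      · exact hg j hj hd
  rw [hcongr] at h
  rw [eq_sub_iff_add_eq']
  exact_mod_cast h

/-- Summed over all nonzero residues, the kernel gives minus its value at zero. -/
lemma sum_logFactor_mul_digitPoly {m : ℕ} {p : (ZMod b)[X]} (hp : Irreducible p)
    (hpm : p.natDegree = m) {y : (ZMod b)[X]} (hy : ¬ p ∣ y) :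
    ∑ n ∈ Ico 1 (b ^ m), logFactor m p (y * digitPoly b n) = -(((b : ℝ) - 1) * m) := by
  have hb : 1 < b := (Fact.out : b.Prime).one_lt
  have h := sum_prod_logFactor hp hpm (g := fun _ => y) (u := {0}) (fun _ _ => hy)
  have hS : dualSum m p (fun _ => y) {0} = 0 := by
    classical
    rw [dualSum, filter_eq_empty_iff.mpr, sum_empty]
    intro k hk hd
    rw [mem_finsupp_iff] at hk
    have hk0 := hk.2 0 (mem_singleton_self 0)
    rw [sum_singleton, ← digitPoly_eq_tr hb (mem_Ico.mp hk0).2] at hd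
    rcases hp.prime.dvd_or_dvd hd with hd | hd
    · exact not_dvd_of_mem_Gstar hpm (digitPoly_mem_Gstar hk0) hd
    · exact hy hd
  rw [hS] at h
  simpa [mul_comm y] using h

/-- `T` split according to the supports of the vectors `k`. -/
lemma T_eq_sum_dualSum (m d : ℕ) (η : Finset ℕ → ℝ) (p : (ZMod b)[X]) (g : ℕ → (ZMod b)[X]) :
    T b m d η p g = ∑ u ∈ (Icc 1 d).powerset.erase ∅, η u * dualSum m p g u := by
  classical
  have hb : 1 < b := (Fact.out : b.Prime).one_lt
  have hN : 0 < b ^ m := Nat.pow_pos (by omega)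
  have htr0 : tr b m 0 = 0 := by simp [tr]
  rw [T, ← sum_fiberwise_of_maps_to (g := Finsupp.support) (t := (Icc 1 d).powerset.erase ∅)]
  · refine sum_congr rfl fun u hu => ?_
    rw [mem_erase, mem_powerset] at hu
    rw [dualSum, mul_sum]
    refine sum_congr ?_ fun k hk => ?_
    · ext k
      simp only [A, mem_filter, mem_erase, mem_finsupp_iff, mem_range, mem_Ico]
      constructor
      · rintro ⟨⟨hk0, ⟨hks, hkN⟩, hd⟩, rfl⟩
        refine ⟨⟨subset_rfl, fun i hi => ⟨?_, hkN i (hks hi)⟩⟩, ?_⟩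
        · exact Nat.one_le_iff_ne_zero.mpr (Finsupp.mem_support_iff.mp hi)
        · rwa [sum_subset hks fun j _ hj => by
            rw [Finsupp.notMem_support_iff.mp hj, htr0, zero_mul]]
      · rintro ⟨⟨hks, hkN⟩, hd⟩
        have hsupp : k.support = u := hks.antisymm fun i hi =>
          Finsupp.mem_support_iff.mpr (by have := (hkN i hi).1; omega)
        refine ⟨⟨?_, ⟨hks.trans hu.2, fun i _ => ?_⟩, ?_⟩, hsupp⟩
        · rintro rfl
          exact hu.1 (by simpa using hsupp.symm)
        · by_cases hi : i ∈ u
          · exact (hkN i hi).2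
          · rw [← hsupp, Finsupp.notMem_support_iff] at hi
            rwa [hi]
        · rwa [← sum_subset hu.2 fun j _ hj => by
            rw [← hsupp, Finsupp.notMem_support_iff] at hj
            rw [hj, htr0, zero_mul]]
    · rw [mem_filter, mem_finsupp_iff] at hk
      have hsupp : k.support = u := hk.1.1.antisymm fun i hi =>
        Finsupp.mem_support_iff.mpr (by have := (mem_Ico.mp (hk.1.2 i hi)).1; omega)
      rw [r1, hsupp, mul_inv, inv_inv, prod_inv_distrib]
  · intro k hk
    simp only [A, mem_filter, mem_erase, mem_finsupp_iff] at hk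
    rw [mem_erase, mem_powerset]
    exact ⟨fun h => hk.1 (Finsupp.support_eq_empty.mp h), hk.2.1.1⟩

end Duality

/-! ### The component-by-component construction -/

section CBC

variable {b : ℕ} [Fact b.Prime]

lemma insert_succ_Icc (s : ℕ) : insert (s + 1) (Icc 1 s) = Icc 1 (s + 1) :=
  insert_Icc_right_eq_Icc_add_one (by omega)

lemma sum_powerset_Icc_succ_erase (f : Finset ℕ → ℝ) (s : ℕ) :
    ∑ u ∈ (Icc 1 (s + 1)).powerset.erase ∅, f u
      = ∑ u ∈ (Icc 1 s).powerset.erase ∅, f u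
        + ∑ v ∈ (Icc 1 s).powerset, f (insert (s + 1) v) := by
  rw [sum_erase_eq_sub (empty_mem_powerset _), sum_erase_eq_sub (empty_mem_powerset _),
    ← insert_succ_Icc, sum_powerset_insert (by simp)]
  ring

lemma succ_notMem_of_mem_powerset {s : ℕ} {v : Finset ℕ} (hv : v ∈ (Icc 1 s).powerset) :
    s + 1 ∉ v := fun h => by
  have := mem_Icc.mp (mem_powerset.mp hv h)
  omega

/-- The part of `K` that depends on the last component `h`, once the first `s` components are
fixed. -/
noncomputable def increment (m s : ℕ) (η : Finset ℕ → ℝ) (p : (ZMod b)[X])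
    (g : ℕ → (ZMod b)[X]) (h : (ZMod b)[X]) : ℝ :=
  ∑ v ∈ (Icc 1 s).powerset, η (insert (s + 1) v) * ∑ n ∈ Ico 1 (b ^ m),
    logFactor m p (digitPoly b n * h) * ∏ j ∈ v, logFactor m p (digitPoly b n * g j)

lemma K_eq (m s : ℕ) (η : Finset ℕ → ℝ) (p : (ZMod b)[X]) (g : ℕ → (ZMod b)[X]) :
    K b m s η p g = ∑ u ∈ (Icc 1 s).powerset.erase ∅, η u * ∑ n ∈ Ico 1 (b ^ m),
      ∏ j ∈ u, logFactor m p (digitPoly b n * g j) := rfl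

lemma K_succ (m s : ℕ) (η : Finset ℕ → ℝ) (p : (ZMod b)[X]) (g : ℕ → (ZMod b)[X]) :
    K b m (s + 1) η p g = K b m s η p g + increment m s η p g (g (s + 1)) := by
  rw [K_eq, K_eq, sum_powerset_Icc_succ_erase, increment]
  congr 1
  refine sum_congr rfl fun v hv => ?_
  congr 1
  exact sum_congr rfl fun n _ => prod_insert (succ_notMem_of_mem_powerset hv)

lemma K_congr {m s : ℕ} (η : Finset ℕ → ℝ) (p : (ZMod b)[X]) {g g' : ℕ → (ZMod b)[X]}
    (h : ∀ j ∈ Icc 1 s, g j = g' j) : K b m s η p g = K b m s η p g' := by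
  rw [K_eq, K_eq]
  refine sum_congr rfl fun u hu => congrArg (η u * ·) (sum_congr rfl fun n _ =>
    prod_congr rfl fun j hj => ?_)
  rw [h j (mem_powerset.mp (mem_of_mem_erase hu) hj)]

lemma increment_congr {m s : ℕ} (η : Finset ℕ → ℝ) (p : (ZMod b)[X]) {g g' : ℕ → (ZMod b)[X]}
    (h : ∀ j ∈ Icc 1 s, g j = g' j) (y : (ZMod b)[X]) :
    increment m s η p g y = increment m s η p g' y := by
  rw [increment, increment]
  refine sum_congr rfl fun v hv => congrArg (η (insert (s + 1) v) * ·) (sum_congr rfl fun n _ =>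
    congrArg (logFactor m p (digitPoly b n * y) * ·) (prod_congr rfl fun j hj => ?_))
  rw [h j (mem_powerset.mp hv hj)]

lemma K_succ_update (m s : ℕ) (η : Finset ℕ → ℝ) (p : (ZMod b)[X]) (g : ℕ → (ZMod b)[X])
    (h : (ZMod b)[X]) :
    K b m (s + 1) η p (Function.update g (s + 1) h)
      = K b m s η p g + increment m s η p g h := by
  have hupd : ∀ j ∈ Icc 1 s, Function.update g (s + 1) h j = g j := fun j hj =>
    Function.update_of_ne (by rw [mem_Icc] at hj; omega) _ _
  rw [K_succ, Function.update_self, K_congr η p hupd, increment_congr η p hupd]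

/-- Averaging over the candidates for the new component replaces its factor by
`-(b - 1) m / (b ^ m - 1)`, and the remaining sums over the points are at least
`-((b - 1) m) ^ |v|`, because adding the term of the point `0` makes them nonnegative. -/
lemma sum_increment_le {m s : ℕ} {η : Finset ℕ → ℝ}
    (hη : ∀ v ∈ (Icc 1 s).powerset, 0 < η (insert (s + 1) v)) {p : (ZMod b)[X]}
    (hp : Irreducible p) (hpm : p.natDegree = m) {g : ℕ → (ZMod b)[X]}
    (hg : ∀ j ∈ Icc 1 s, g j ∈ Gstar b m) :
    ∑ n ∈ Ico 1 (b ^ m), increment m s η p g (digitPoly b n)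
      ≤ ∑ v ∈ (Icc 1 s).powerset, η (insert (s + 1) v) * (((b : ℝ) - 1) * m) ^ (v.card + 1) := by
  have hb : (1 : ℝ) < b := by exact_mod_cast (Fact.out : b.Prime).one_lt
  simp only [increment]
  rw [sum_comm]
  refine sum_le_sum fun v hv => ?_
  rw [← mul_sum, sum_comm]
  refine mul_le_mul_of_nonneg_left ?_ (hη v hv).le
  have hinner : ∀ n ∈ Ico 1 (b ^ m), ∑ n' ∈ Ico 1 (b ^ m),
      logFactor m p (digitPoly b n * digitPoly b n') * ∏ j ∈ v, logFactor m p (digitPoly b n * g j)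
      = -(((b : ℝ) - 1) * m) * ∏ j ∈ v, logFactor m p (digitPoly b n * g j) := fun n hn => by
    rw [← sum_mul, sum_logFactor_mul_digitPoly hp hpm
      (not_dvd_of_mem_Gstar hpm (digitPoly_mem_Gstar hn))]
  rw [sum_congr rfl hinner, ← mul_sum, sum_prod_logFactor hp hpm fun j hj =>
    not_dvd_of_mem_Gstar hpm (hg j (mem_powerset.mp hv hj))]
  have hM : 0 ≤ ((b : ℝ) - 1) * m := mul_nonneg (by linarith) (Nat.cast_nonneg m)
  have := mul_nonneg hM (mul_nonneg (pow_nonneg (by linarith : (0 : ℝ) ≤ b) m)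
    (dualSum_nonneg m p g v))
  rw [pow_succ]
  linarith

lemma increment_zero_one {m : ℕ} (η : Finset ℕ → ℝ) {p : (ZMod b)[X]}
    (hp : Irreducible p) (hpm : p.natDegree = m) (g : ℕ → (ZMod b)[X]) :
    increment m 0 η p g 1 = -(((b : ℝ) - 1) * m) * η {1} := by
  have h := sum_logFactor_mul_digitPoly hp hpm (y := 1)
    (fun h => hp.not_isUnit (isUnit_of_dvd_one h))
  simp only [one_mul] at h
  simp [increment, h, mul_comm]

lemma IsCBC.mem_Gstar {m d : ℕ} {η : Finset ℕ → ℝ} {p : (ZMod b)[X]} {g : ℕ → (ZMod b)[X]}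
    (h : IsCBC b m d η p g) (hm : 0 < m) {j : ℕ} (hj : j ∈ Icc 1 d) : g j ∈ Gstar b m := by
  rw [mem_Icc] at hj
  rcases hj.1.eq_or_lt with rfl | hlt
  · rw [h.1]
    exact ⟨one_ne_zero, by simpa using hm⟩
  · exact (h.2 j (mem_Icc.mpr ⟨hlt, hj.2⟩)).1

/-- The minimizing component does at least as well as the average over all candidates. -/
lemma K_le_of_isCBC {m d : ℕ} (hm : 0 < m) {η : Finset ℕ → ℝ} (hη : ∀ u ⊆ Icc 1 d, 0 < η u)
    {p : (ZMod b)[X]} (hp : Irreducible p) (hpm : p.natDegree = m) {g : ℕ → (ZMod b)[X]}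
    (hg : IsCBC b m d η p g) {s : ℕ} (hs : s ≤ d) :
    ((b : ℝ) ^ m - 1) * K b m s η p g
      ≤ ∑ u ∈ (Icc 1 s).powerset.erase ∅, η u * (((b : ℝ) - 1) * m) ^ u.card := by
  have hb : (1 : ℝ) < b := by exact_mod_cast (Fact.out : b.Prime).one_lt
  have hM : 0 ≤ ((b : ℝ) - 1) * m := mul_nonneg (by linarith) (Nat.cast_nonneg m)
  have hN : (1 : ℝ) ≤ (b : ℝ) ^ m := one_le_pow₀ hb.le
  induction s with
  | zero => simp [K_eq]
  | succ s ih =>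
    have hη' : ∀ v ∈ (Icc 1 s).powerset, 0 < η (insert (s + 1) v) := fun v hv =>
      hη _ (insert_subset (by rw [mem_Icc]; omega)
        ((mem_powerset.mp hv).trans (Icc_subset_Icc_right (by omega))))
    have hcard : ∀ v ∈ (Icc 1 s).powerset,
        η (insert (s + 1) v) * (((b : ℝ) - 1) * m) ^ (insert (s + 1) v).card
        = η (insert (s + 1) v) * (((b : ℝ) - 1) * m) ^ (v.card + 1) := fun v hv => by
      rw [card_insert_of_notMem (succ_notMem_of_mem_powerset hv)]
    rw [K_succ, sum_powerset_Icc_succ_erase, sum_congr rfl hcard, mul_add]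
    refine add_le_add (ih (by omega)) ?_
    rcases Nat.eq_zero_or_pos s with rfl | hs0
    · rw [hg.1, increment_zero_one η hp hpm]
      have h1 : 0 < η {1} := hη _ (by simpa using hs)
      have h2 := mul_nonneg hM h1.le
      have h3 : 0 ≤ ((b : ℝ) ^ m - 1) * (((b : ℝ) - 1) * m * η {1}) :=
        mul_nonneg (by linarith) h2
      simp only [zero_add, Icc_eq_empty_of_lt Nat.zero_lt_one, powerset_empty, sum_singleton,
        insert_empty_eq, card_empty, pow_one]
      linarith
    · refine le_trans ?_ (sum_increment_le hη' hp hpm fun j hj =>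
        hg.mem_Gstar hm (Icc_subset_Icc_right (by omega) hj))
      have hmin := (hg.2 (s + 1) (mem_Icc.mpr ⟨by omega, hs⟩)).2
      have hcardN : ((b : ℝ) ^ m - 1) = ((Ico 1 (b ^ m)).card : ℝ) := by
        rw [Nat.card_Ico, Nat.cast_sub (Nat.one_le_pow _ _ (Fact.out : b.Prime).pos)]
        push_cast
        ring
      rw [hcardN, ← nsmul_eq_mul]
      refine card_nsmul_le_sum _ _ _ fun n hn => ?_
      have := hmin _ (digitPoly_mem_Gstar hn)
      rw [K_succ, K_succ_update] at this
      linarith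

/-- The quality measure of a lattice found by the component-by-component construction. -/
lemma T_le_of_isCBC {m d : ℕ} (hm : 0 < m) {η : Finset ℕ → ℝ} (hη : ∀ u ⊆ Icc 1 d, 0 < η u)
    {p : (ZMod b)[X]} (hp : Irreducible p) (hpm : p.natDegree = m) {g : ℕ → (ZMod b)[X]}
    (hg : IsCBC b m d η p g) :
    T b m d η p g ≤ 1 / (b : ℝ) ^ m
      * ∑ u ∈ (Icc 1 d).powerset.erase ∅, η u * (2 * (((b : ℝ) - 1) * m) ^ u.card) := by
  have hb2 : (2 : ℝ) ≤ b := by exact_mod_cast (Fact.out : b.Prime).two_le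
  have hN : (2 : ℝ) ≤ (b : ℝ) ^ m := hb2.trans (le_self_pow₀ (by linarith) hm.ne')
  have hM : 0 ≤ ((b : ℝ) - 1) * m := mul_nonneg (by linarith) (Nat.cast_nonneg m)
  set F := ∑ u ∈ (Icc 1 d).powerset.erase ∅, η u * (((b : ℝ) - 1) * m) ^ u.card with hF
  have hF0 : 0 ≤ F := sum_nonneg fun u hu => mul_nonneg
    (hη u (mem_powerset.mp (mem_of_mem_erase hu))).le (pow_nonneg hM _)
  have hK := K_le_of_isCBC hm hη hp hpm hg le_rfl
  have hKF : K b m d η p g ≤ F := by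
    by_contra! hlt
    have : K b m d η p g ≤ ((b : ℝ) ^ m - 1) * K b m d η p g :=
      le_mul_of_one_le_left (hF0.trans hlt.le) (by linarith)
    linarith
  have hT : (b : ℝ) ^ m * T b m d η p g = F + K b m d η p g := by
    rw [T_eq_sum_dualSum, K_eq, hF, mul_sum, ← sum_add_distrib]
    refine sum_congr rfl fun u hu => ?_
    rw [sum_prod_logFactor hp hpm fun j hj => not_dvd_of_mem_Gstar hpm
      (hg.mem_Gstar hm (mem_powerset.mp (mem_of_mem_erase hu) hj))]
    ring
  have hdouble : ∑ u ∈ (Icc 1 d).powerset.erase ∅, η u * (2 * (((b : ℝ) - 1) * m) ^ u.card)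
      = 2 * F := by
    rw [hF, mul_sum]
    exact sum_congr rfl fun u _ => by ring
  rw [hdouble, one_div, le_inv_mul_iff₀ (by linarith), hT]
  linarith

lemma T_le_bound {m d : ℕ} (hm : 0 < m) {η : Finset ℕ → ℝ} (hη : ∀ u ⊆ Icc 1 d, 0 < η u)
    {p : (ZMod b)[X]} (hp : Irreducible p) (hpm : p.natDegree = m) {g : ℕ → (ZMod b)[X]}
    (hg : IsCBC b m d η p g) : T b m d η p g ≤ bound b m d η := by
  have hb : (0 : ℝ) < (b : ℝ) - 1 := by
    have : (1 : ℝ) < b := by exact_mod_cast (Fact.out : b.Prime).one_lt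
    linarith
  refine (T_le_of_isCBC hm hη hp hpm hg).trans ?_
  rw [bound]
  gcongr with u hu
  · exact (hη u (mem_powerset.mp (mem_of_mem_erase hu))).le
  · exact le_add_of_nonneg_right (by positivity)

end CBC

/-! ### A dimension-free bound -/

section DimensionFree

lemma maxRatio_nonneg {η : Finset ℕ → ℝ} (hη : ∀ u : Finset ℕ, 0 ∉ u → 0 < η u) {j : ℕ}
    (hj : 1 ≤ j) : 0 ≤ maxRatio η j := by
  refine le_trans ?_ (le_sup' (f := fun v => η (insert j v) / η v) (empty_mem_powerset _))
  exact (div_pos (hη _ (by simp; omega)) (hη _ (by simp))).le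

lemma sum_weights_le_prod {η : Finset ℕ → ℝ} (hη : ∀ u : Finset ℕ, 0 ∉ u → 0 < η u) {X : ℝ}
    (hX : 0 ≤ X) (d : ℕ) :
    ∑ u ∈ (Icc 1 d).powerset, η u * X ^ u.card
      ≤ η ∅ * ∏ j ∈ range d, (1 + X * maxRatio η (j + 1)) := by
  induction d with
  | zero => simp
  | succ d ih =>
    rw [← insert_succ_Icc, sum_powerset_insert (by simp), prod_range_succ, ← mul_assoc]
    have hstep : ∑ v ∈ (Icc 1 d).powerset, η (insert (d + 1) v) * X ^ (insert (d + 1) v).card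
        ≤ (X * maxRatio η (d + 1)) * ∑ v ∈ (Icc 1 d).powerset, η v * X ^ v.card := by
      rw [mul_sum]
      refine sum_le_sum fun v hv => ?_
      have hv0 : 0 < η v := hη v fun h => by simpa using mem_powerset.mp hv h
      have hle : η (insert (d + 1) v) ≤ maxRatio η (d + 1) * η v := by
        rw [← div_le_iff₀ hv0]
        exact le_sup' (f := fun v => η (insert (d + 1) v) / η v)
          (by rwa [show Ico 1 (d + 1) = Icc 1 d from Ico_add_one_right_eq_Icc 1 d])
      rw [card_insert_of_notMem (succ_notMem_of_mem_powerset hv), pow_succ]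
      calc η (insert (d + 1) v) * (X ^ v.card * X)
          ≤ maxRatio η (d + 1) * η v * (X ^ v.card * X) := by gcongr
        _ = X * maxRatio η (d + 1) * (η v * X ^ v.card) := by ring
    have hc := mul_nonneg hX (maxRatio_nonneg hη (j := d + 1) (by omega))
    calc _ ≤ (1 + X * maxRatio η (d + 1)) * ∑ v ∈ (Icc 1 d).powerset, η v * X ^ v.card := by
          linarith
      _ ≤ _ := by
          rw [mul_comm]
          gcongr

lemma one_add_le_exp_div {θ y : ℝ} (hθ : 0 < θ) (hθ1 : θ ≤ 1) :
    1 + y ≤ θ⁻¹ * Real.exp (θ * y) := by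
  rw [le_inv_mul_iff₀ hθ]
  linarith [Real.add_one_le_exp (θ * y)]

/-- The product has subexponential growth in `X`, uniformly in `d`: only finitely many factors are
not controlled by the tail of `∑ c j`; each of these contributes an arbitrarily small exponent at
the price of a constant. -/
lemma exists_mul_prod_le_exp {c : ℕ → ℝ} (hc : ∀ j, 0 ≤ c j) (hsum : Summable c) {ε : ℝ}
    (hε : 0 < ε) :
    ∃ C : ℝ, 0 < C ∧ ∀ X : ℝ, 0 ≤ X → ∀ d : ℕ,
      X * ∏ j ∈ range d, (1 + X * c j) ≤ C * Real.exp (ε * X) := by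
  obtain ⟨J, hJ⟩ : ∃ J, ∑' j, c (j + J) < ε / 2 :=
    ((tendsto_sum_nat_add c).eventually_lt_const (half_pos hε)).exists
  set S := ∑' j, c j with hS
  have hS0 : 0 ≤ S := tsum_nonneg hc
  -- `θ` is spent on the factor `X` and on the head `∑_{j < J} c j ≤ S`, so `θ (1 + S) ≤ ε / 2`.
  set θ := min 1 (ε / (2 * (1 + S))) with hθdef
  have hθ : 0 < θ := by positivity
  have hθ1 : θ ≤ 1 := min_le_left _ _
  have hθS : θ * (1 + S) ≤ ε / 2 := by
    calc θ * (1 + S) ≤ ε / (2 * (1 + S)) * (1 + S) := by gcongr; exact min_le_right _ _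
      _ = ε / 2 := by field_simp
  refine ⟨θ⁻¹ * θ⁻¹ ^ J, by positivity, fun X hX d => ?_⟩
  have hfac : ∀ j, 0 ≤ 1 + X * c j := fun j => by have := mul_nonneg hX (hc j); linarith
  have hone : ∀ j, 1 ≤ 1 + X * c j := fun j => by have := mul_nonneg hX (hc j); linarith
  have hlinear : X ≤ θ⁻¹ * Real.exp (θ * X) := by
    linarith [one_add_le_exp_div (y := X) hθ hθ1]
  have hmono : ∏ j ∈ range d, (1 + X * c j) ≤ ∏ j ∈ range (J + d), (1 + X * c j) :=
    monotone_nat_of_le_succ (f := fun n => ∏ j ∈ range n, (1 + X * c j)) (fun n => by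
      rw [prod_range_succ]
      exact le_mul_of_one_le_right (prod_nonneg fun j _ => hfac j) (hone n))
      (Nat.le_add_left d J)
  have hhead : ∏ j ∈ range J, (1 + X * c j) ≤ θ⁻¹ ^ J * Real.exp (θ * X * S) := by
    calc ∏ j ∈ range J, (1 + X * c j)
        ≤ ∏ j ∈ range J, (θ⁻¹ * Real.exp (θ * (X * c j))) :=
          prod_le_prod (fun j _ => hfac j) fun j _ => one_add_le_exp_div hθ hθ1
      _ = θ⁻¹ ^ J * Real.exp (θ * X * ∑ j ∈ range J, c j) := by
          rw [prod_mul_distrib, prod_const, card_range, ← Real.exp_sum, mul_sum]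
          simp only [mul_assoc]
      _ ≤ _ := by
          gcongr
          exact hsum.sum_le_tsum _ fun j _ => hc j
  have htail : ∏ j ∈ range d, (1 + X * c (J + j)) ≤ Real.exp (X * (ε / 2)) := by
    calc ∏ j ∈ range d, (1 + X * c (J + j)) ≤ ∏ j ∈ range d, Real.exp (X * c (J + j)) :=
          prod_le_prod (fun j _ => hfac _) fun j _ => by
            linarith [Real.add_one_le_exp (X * c (J + j))]
      _ = Real.exp (X * ∑ j ∈ range d, c (j + J)) := by
          rw [← Real.exp_sum, mul_sum]
          simp only [add_comm J]
      _ ≤ _ := by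
          gcongr
          exact (((summable_nat_add_iff J).mpr hsum).sum_le_tsum _ fun j _ => hc _).trans hJ.le
  have hhead0 : 0 ≤ ∏ j ∈ range J, (1 + X * c j) := prod_nonneg fun j _ => hfac j
  calc X * ∏ j ∈ range d, (1 + X * c j)
      ≤ (θ⁻¹ * Real.exp (θ * X)) * ((θ⁻¹ ^ J * Real.exp (θ * X * S))
        * Real.exp (X * (ε / 2))) := by
        refine mul_le_mul hlinear (hmono.trans ?_) (prod_nonneg fun j _ => hfac j) (by positivity)
        rw [prod_range_add]
        exact mul_le_mul hhead htail (prod_nonneg fun j _ => hfac _) (by positivity)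
    _ = θ⁻¹ * θ⁻¹ ^ J * Real.exp (θ * (1 + S) * X + X * (ε / 2)) := by
        rw [show θ * (1 + S) * X + X * (ε / 2) = θ * X + (θ * X * S + X * (ε / 2)) by ring,
          Real.exp_add, Real.exp_add]
        ring
    _ ≤ θ⁻¹ * θ⁻¹ ^ J * Real.exp (ε * X) := by
        gcongr
        linarith [mul_le_mul_of_nonneg_right hθS hX]

/-- Both summands of the bound are absorbed by the single geometric term `(2 b m) ^ |u|`. -/
lemma bound_le {b m d : ℕ} (hb : 2 ≤ b) (hm : 4 ≤ m) {η : Finset ℕ → ℝ}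
    (hη : ∀ u ⊆ Icc 1 d, 0 < η u) :
    bound b m d η ≤ 1 / (b : ℝ) ^ m * ((2 * b * m)
      * ∑ u ∈ (Icc 1 d).powerset, η u * (2 * b * m : ℝ) ^ u.card) := by
  have hbR : (2 : ℝ) ≤ b := by exact_mod_cast hb
  have hmR : (4 : ℝ) ≤ m := by exact_mod_cast hm
  have hb1 : (0 : ℝ) < (b : ℝ) - 1 := by linarith
  rw [bound]
  refine mul_le_mul_of_nonneg_left ?_ (by positivity)
  rw [mul_sum]
  refine (sum_le_sum fun u hu => ?_).trans (sum_le_sum_of_subset_of_nonneg (erase_subset _ _)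
    fun u hu _ => mul_nonneg (by positivity : (0 : ℝ) ≤ 2 * b * m)
      (mul_nonneg (hη u (mem_powerset.mp hu)).le (by positivity)))
  rw [mul_left_comm]
  refine mul_le_mul_of_nonneg_left ?_ (hη u (mem_powerset.mp (mem_of_mem_erase hu))).le
  have hfrac : 2 * (b : ℝ) / ((b : ℝ) - 1) ≤ 4 := by
    rw [div_le_iff₀ hb1]
    linarith
  have h1 : (((b : ℝ) - 1) * m) ^ u.card ≤ (2 * b * m : ℝ) ^ u.card := by
    apply pow_le_pow_left₀ (by positivity)
    nlinarith
  have h2 : (2 * ((b : ℝ) - 1) * m + 2 * b / ((b : ℝ) - 1)) ^ u.card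
      ≤ (2 * b * m : ℝ) ^ u.card := by
    apply pow_le_pow_left₀ (by positivity)
    nlinarith
  have hbm : (2 : ℝ) ≤ b * m := by nlinarith
  have hP : (0 : ℝ) ≤ (2 * b * m : ℝ) ^ u.card := by positivity
  calc _ ≤ 2 * (2 * b * m : ℝ) ^ u.card + b * m * (2 * b * m : ℝ) ^ u.card := by gcongr
    _ ≤ _ := by nlinarith

lemma exists_bound_le_rpow {b : ℕ} (hb : 2 ≤ b) {η : Finset ℕ → ℝ}
    (hη : ∀ u : Finset ℕ, 0 ∉ u → 0 < η u) (hsum : Summable fun j : ℕ => maxRatio η (j + 1))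
    {δ : ℝ} (hδ : 0 < δ) :
    ∃ C : ℝ, 0 < C ∧ ∀ m d : ℕ, 4 ≤ m → bound b m d η ≤ C * ((b : ℝ) ^ m) ^ (-1 + δ) := by
  have hbR : (2 : ℝ) ≤ b := by exact_mod_cast hb
  have hb0 : (0 : ℝ) < b := by linarith
  have hlog : 0 < Real.log b := Real.log_pos (by linarith)
  obtain ⟨C, hC, hprod⟩ := exists_mul_prod_le_exp
    (fun j => maxRatio_nonneg hη (j := j + 1) (by omega)) hsum
    (ε := δ * Real.log b / (2 * b)) (by positivity)
  have hempty : 0 < η ∅ := hη ∅ (by simp)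
  refine ⟨η ∅ * C, by positivity, fun m d hm => ?_⟩
  have hX : (0 : ℝ) ≤ 2 * b * m := by positivity
  have hexp : Real.exp (δ * Real.log b / (2 * b) * (2 * b * m)) = ((b : ℝ) ^ m) ^ δ := by
    rw [Real.rpow_def_of_pos (by positivity), Real.log_pow]
    congr 1
    field_simp
  calc bound b m d η
      ≤ 1 / (b : ℝ) ^ m * ((2 * b * m)
        * ∑ u ∈ (Icc 1 d).powerset, η u * (2 * b * m : ℝ) ^ u.card) :=
        bound_le hb hm fun u hu => hη u fun h => by simpa using hu h
    _ ≤ 1 / (b : ℝ) ^ m * ((2 * b * m)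
        * (η ∅ * ∏ j ∈ range d, (1 + (2 * b * m : ℝ) * maxRatio η (j + 1)))) := by
        gcongr
        exact sum_weights_le_prod hη hX d
    _ = 1 / (b : ℝ) ^ m * (η ∅ * ((2 * b * m)
        * ∏ j ∈ range d, (1 + (2 * b * m : ℝ) * maxRatio η (j + 1)))) := by ring
    _ ≤ 1 / (b : ℝ) ^ m * (η ∅ * (C * ((b : ℝ) ^ m) ^ δ)) := by
        rw [← hexp]
        exact mul_le_mul_of_nonneg_left (mul_le_mul_of_nonneg_left (hprod _ hX d) hempty.le)
          (by positivity)
    _ = η ∅ * C * ((b : ℝ) ^ m) ^ (-1 + δ) := by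
        rw [Real.rpow_add (by positivity), Real.rpow_neg_one, one_div]
        ring

end DimensionFree

end PolyLat

theorem theorem4 (b : ℕ) [Fact b.Prime] :
    -- the explicit estimate, for arbitrary positive weights on the subsets of {1, …, d}
    (∀ (m d : ℕ), 4 ≤ m → 1 ≤ d →
      ∀ η : Finset ℕ → ℝ, (∀ u ⊆ Finset.Icc 1 d, 0 < η u) →
      ∀ p : Polynomial (ZMod b), Irreducible p → p.natDegree = m →
      ∀ g : ℕ → Polynomial (ZMod b), PolyLat.IsCBC b m d η p g →
        PolyLat.T b m d η p g ≤ PolyLat.bound b m d η) ∧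
    -- the bound independent of the dimension, with constant depending only on b, the weights and δ
    (∀ η : Finset ℕ → ℝ, (∀ u : Finset ℕ, 0 ∉ u → 0 < η u) →
      Summable (fun j : ℕ => PolyLat.maxRatio η (j + 1)) →
      ∀ δ : ℝ, 0 < δ → ∃ C : ℝ, 0 < C ∧ ∀ (m d : ℕ), 4 ≤ m → 1 ≤ d →
        PolyLat.bound b m d η ≤ C * ((b : ℝ) ^ m) ^ (-1 + δ) ∧
        ∀ p : Polynomial (ZMod b), Irreducible p → p.natDegree = m →
        ∀ g : ℕ → Polynomial (ZMod b), PolyLat.IsCBC b m d η p g →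
          PolyLat.T b m d η p g ≤ C * ((b : ℝ) ^ m) ^ (-1 + δ)) := by
  have hb : 2 ≤ b := (Fact.out : b.Prime).two_le
  refine ⟨fun m d hm _ η hη p hp hpm g hg => PolyLat.T_le_bound (by omega) hη hp hpm hg,
    fun η hη hsum δ hδ => ?_⟩
  obtain ⟨C, hC, hbound⟩ := PolyLat.exists_bound_le_rpow hb hη hsum hδ
  refine ⟨C, hC, fun m d hm _ => ⟨hbound m d hm, fun p hp hpm g hg => ?_⟩⟩
  exact (PolyLat.T_le_bound (by omega) (fun u hu => hη u fun h => by simpa using hu h)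
    hp hpm hg).trans (hbound m d hm)
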